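/- Let $K$ be a compact hypergroup in the sense of Jewett: a compact Hausdorff space $K$ together with a bilinear, associative convolution $*$ on the space $M(K)$ of bounded regular complex Borel measures on $K$, weakly continuous in each variable (for the weak topology induced by the bounded continuous functions), such that (i) for $x,y\in K$, $\delta_x*\delta_y$ is a probability measure with compact support; (ii) $(x,y)\mapsto\operatorname{supp}(\delta_x*\delta_y)$ is continuous into the nonvoid compact subsets of $K$ with the Michael (Vietoris) topology; (iii) $(x,y)\mapsto\delta_x*\delta_y$ is continuous into $M(K)$ with the weak topology; (iv) there is $e\in K$ with $\delta_e*\delta_x=\delta_x*\delta_e=\delta_x$ for all $x\in K$; (v) there is a continuous involution $x\mapsto\check x$ of $K$ such that $(\delta_x*\delta_y)\check{}=\delta_{\check y}*\delta_{\check x}$ (where $\check\mu$ is the image of $\mu$ under the involution), and $e\in\operatorname{supp}(\delta_x*\delta_y)$ if and only if $x=\check y$. Let $\omega\in M(K)$ be a normalized Haar measure on $K$, that is, a regular Borel probability measure with $\delta_x*\omega=\omega$ for all $x\in K$. Let $\sigma\in M(K)$ be an adapted probability measure, that is, $$K=\overline{\bigcup_{n=1}^{\infty}\bigl(\operatorname{supp}\sigma\cup(\operatorname{supp}\sigma)\check{}\,\bigr)^n},$$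 where $A*B=\bigcup_{x\in A,\,y\in B}\operatorname{supp}(\delta_x*\delta_y)$ and $A^1=A$, $A^{n+1}=A^n*A$. Then the set $H_\sigma(K)=\{\mu\in M(K):\sigma*\mu=\mu\}$ of $\sigma$-harmonic measures is exactly $$H_\sigma(K)=\mathbb{C}\,\omega=\{c\,\omega: c\in\mathbb{C}\}.$$ -/

import Mathlib

open MeasureTheory Set Topology
open scoped BoundedContinuousFunction ENNReal NNReal

noncomputable section

namespace HypergroupTheory

section BoundedRegularMeasures

/-- A finite measure dominated by the sum of two finite regular measures is regular. -/
theorem regular_of_le_add {K : Type*} [TopologicalSpace K] [MeasurableSpace K] [BorelSpace K]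
    [T2Space K] {μ ν ρ : Measure K} [IsFiniteMeasure μ] [IsFiniteMeasure ν] [IsFiniteMeasure ρ]
    [μ.Regular] [ν.Regular] (h : ρ ≤ μ + ν) : ρ.Regular := by
  have key : ∀ A : Set K, MeasurableSet A → ∀ ε : ℝ≥0∞, ε ≠ 0 →
      ∃ C, C ⊆ A ∧ IsCompact C ∧ ρ (A \ C) < ε := by
    intro A hA ε hε
    have hε2 : ε / 2 ≠ 0 := by simpa using hε
    obtain ⟨C₁, hC₁, hc₁, h₁⟩ := hA.exists_isCompact_sdiff_lt (measure_ne_top μ A) hε2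
    obtain ⟨C₂, hC₂, hc₂, h₂⟩ := hA.exists_isCompact_sdiff_lt (measure_ne_top ν A) hε2
    refine ⟨C₁ ∪ C₂, union_subset hC₁ hC₂, hc₁.union hc₂, ?_⟩
    calc ρ (A \ (C₁ ∪ C₂)) ≤ (μ + ν) (A \ (C₁ ∪ C₂)) := h _
      _ = μ (A \ (C₁ ∪ C₂)) + ν (A \ (C₁ ∪ C₂)) := rfl
      _ ≤ μ (A \ C₁) + ν (A \ C₂) := by
        gcongr
        · exact subset_union_left
        · exact subset_union_right
      _ < ε / 2 + ε / 2 := ENNReal.add_lt_add h₁ h₂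
      _ = ε := ENNReal.add_halves ε
  have inner : ∀ A : Set K, MeasurableSet A → ∀ r < ρ A, ∃ C, C ⊆ A ∧ IsCompact C ∧ r < ρ C := by
    intro A hA r hr
    obtain ⟨C, hCA, hC, hlt⟩ := key A hA (ρ A - r) (tsub_pos_of_lt hr).ne'
    refine ⟨C, hCA, hC, ?_⟩
    by_contra hcon
    have h1 : ρ A ≤ ρ C + ρ (A \ C) := by
      calc ρ A ≤ ρ (C ∪ (A \ C)) := measure_mono (by simp)
        _ ≤ _ := measure_union_le _ _
    have h2 : ρ C + ρ (A \ C) < r + (ρ A - r) :=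
      ENNReal.add_lt_add_of_le_of_lt (measure_ne_top ρ C) (not_lt.1 hcon) hlt
    rw [add_tsub_cancel_of_le hr.le] at h2
    exact absurd h2 (not_lt.2 h1)
  have : ρ.InnerRegular := ⟨fun A hA r hr => by
    obtain ⟨C, h1, h2, h3⟩ := inner A hA r hr
    exact ⟨C, h1, h2, h3⟩⟩
  infer_instance

variable (K : Type*) [TopologicalSpace K] [MeasurableSpace K] [BorelSpace K] [T2Space K]

/-- The space `M(K)` of all bounded regular complex Borel measures on `K`: the complex measures
whose total variation measure is finite and regular. -/
def boundedRegularMeasures : Submodule ℂ (ComplexMeasure K) where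
  carrier := {μ | IsFiniteMeasure μ.variation ∧ μ.variation.Regular}
  zero_mem' := by
    simp only [mem_ofPred_eq, VectorMeasure.variation_zero]
    exact ⟨inferInstance, inferInstance⟩
  add_mem' := by
    rintro μ ν ⟨h1, h2⟩ ⟨h3, h4⟩
    have hle := VectorMeasure.variation_add_le (μ := μ) (ν := ν)
    have : IsFiniteMeasure (μ + ν).variation := isFiniteMeasure_of_le _ hle
    exact ⟨this, regular_of_le_add hle⟩
  smul_mem' := by
    rintro c μ ⟨h1, h2⟩
    simp only [mem_ofPred_eq, VectorMeasure.variation_smul]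
    exact ⟨inferInstance, inferInstance⟩

variable {K}

/-- The pairing `⟨μ, f⟩ = ∫ f dμ` of a bounded regular complex measure with a bounded
continuous function. -/
def pairing (μ : boundedRegularMeasures K) (f : K →ᵇ ℂ) : ℂ :=
  VectorMeasure.integral (μ : ComplexMeasure K) f (ContinuousLinearMap.mul ℝ ℂ)

/-- `M(K)` carries the weak topology: the coarsest one for which `μ ↦ ∫ f dμ` is continuous for
every bounded continuous `f`. -/
instance weakTopology : TopologicalSpace (boundedRegularMeasures K) :=
  .induced (fun μ (f : K →ᵇ ℂ) => pairing μ f) inferInstance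

/-- The support of `|μ|`. -/
def supp (μ : boundedRegularMeasures K) : Set K := (μ : ComplexMeasure K).variation.support

/-- `μ ∈ M(K)` is a (necessarily regular) probability measure. -/
def IsProbability (μ : boundedRegularMeasures K) : Prop :=
  ∃ P : Measure K, IsProbabilityMeasure P ∧
    ∀ A, MeasurableSet A → (μ : ComplexMeasure K) A = ((P.real A : ℝ) : ℂ)

/-- The point mass `δ_x`. -/
def delta (x : K) : boundedRegularMeasures K :=
  ⟨VectorMeasure.dirac x (1 : ℂ), by
    have : (Measure.dirac x).InnerRegular := ⟨fun A hA r hr => by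
      by_cases hx : x ∈ A
      · refine ⟨{x}, by simpa using hx, isCompact_singleton, ?_⟩
        simpa [Measure.dirac_apply' x hA, hx] using hr
      · simp [Measure.dirac_apply' x hA, hx] at hr⟩
    change IsFiniteMeasure _ ∧ Measure.Regular _
    simp only [VectorMeasure.variation_dirac, enorm_one, one_smul]
    exact ⟨inferInstance, inferInstance⟩⟩

end BoundedRegularMeasures

/-- A hypergroup structure on a locally compact Hausdorff space `K`. -/
structure Hypergroup (K : Type*) [TopologicalSpace K] [LocallyCompactSpace K] [T2Space K]
    [MeasurableSpace K] [BorelSpace K] where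
  /-- The bilinear convolution on `M(K)`. -/
  conv : boundedRegularMeasures K →ₗ[ℂ] boundedRegularMeasures K →ₗ[ℂ] boundedRegularMeasures K
  conv_assoc : ∀ μ ν ρ, conv (conv μ ν) ρ = conv μ (conv ν ρ)
  /-- Convolution is weakly continuous (in each variable). -/
  continuous_conv_left : ∀ μ, Continuous fun ν => conv μ ν
  continuous_conv_right : ∀ ν, Continuous fun μ => conv μ ν
  isProbability_conv_delta : ∀ x y, IsProbability (conv (delta x) (delta y))
  /-- The supports of `δ_x * δ_y` are nonvoid compact sets that depend continuously on `(x, y)`.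
  Mathlib's topology on `NonemptyCompacts K` is the Vietoris (Michael) topology. -/
  continuous_supp : ∃ S : K × K → TopologicalSpace.NonemptyCompacts K, Continuous S ∧
    ∀ x y, (S (x, y) : Set K) = supp (conv (delta x) (delta y))
  continuous_conv_delta : Continuous fun p : K × K => conv (delta p.1) (delta p.2)
  /-- The identity. -/
  e : K
  e_conv : ∀ x, conv (delta e) (delta x) = delta x
  conv_e : ∀ x, conv (delta x) (delta e) = delta x
  /-- The involution. -/
  inv : K → K
  continuous_inv : Continuous inv
  inv_inv : ∀ x, inv (inv x) = x
  map_inv_conv : ∀ x y,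
    VectorMeasure.map (conv (delta x) (delta y) : ComplexMeasure K) inv =
      (conv (delta (inv y)) (delta (inv x)) : ComplexMeasure K)
  e_mem_supp_iff : ∀ x y, e ∈ supp (conv (delta x) (delta y)) ↔ x = inv y

namespace Hypergroup

variable {K : Type*} [TopologicalSpace K] [LocallyCompactSpace K] [T2Space K]
  [MeasurableSpace K] [BorelSpace K] (H : Hypergroup K)

/-- The product of subsets, `A * B = ⋃_{x ∈ A, y ∈ B} supp (δ_x * δ_y)`. -/
def setMul (A B : Set K) : Set K :=
  ⋃ x ∈ A, ⋃ y ∈ B, supp (H.conv (delta x) (delta y))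

/-- `setPow A n` is the `(n + 1)`-fold product `A * ⋯ * A`. -/
def setPow (H : Hypergroup K) (A : Set K) : ℕ → Set K
  | 0 => A
  | n + 1 => H.setMul (H.setPow A n) A

/-- `μ` is adapted: the powers `(supp |μ| ∪ (supp |μ|)ˇ)ⁿ`, `n ≥ 1`, have dense union. -/
def IsAdapted (μ : boundedRegularMeasures K) : Prop :=
  closure (⋃ n : ℕ, H.setPow (supp μ ∪ H.inv '' supp μ) n) = univ

/-- The set `H_σ(K)` of all `σ`-harmonic measures `μ ∈ M(K)`. -/
def harmonicMeasures (σ : boundedRegularMeasures K) : Set (boundedRegularMeasures K) :=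
  {μ | H.conv σ μ = μ}

/-- `ω` is a normalized left Haar measure: a left invariant Radon probability measure. -/
def IsNormalizedHaar (ω : boundedRegularMeasures K) : Prop :=
  IsProbability ω ∧ ∀ x, H.conv (delta x) ω = ω

end Hypergroup

end HypergroupTheory

end

/-!
Let `μ` be `σ`-harmonic. For every bounded continuous `f` the function `h x = ∫ f d(δ_x * μ)` is
`σ`-harmonic: `h x = ∫ h d(δ_x * σ)`. By Jensen's inequality `|h x|² ≤ ∫ |h|² d(δ_x * σ)`, and the
Haar measure, which is also right invariant and has full support, integrates the difference of the
two sides to zero. Hence the variance of `h` under `δ_x * σ` vanishes and `h = h x` on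
`supp (δ_x * δ_y)` for `y ∈ supp σ`. Since `t ∈ supp (δ_x * δ_yˇ)` implies `x ∈ supp (δ_t * δ_y)`,
the same holds for `y ∈ (supp σ)ˇ`. So `h` is constant on the closed subhypergroup generated by
`supp σ`, that is, `μ` is invariant under it.

An invariant `μ` is a multiple of the right invariant measure `ωˇ` because `ωˇ * μ` is both
`ωˇ(K) μ` and `μ(K) ωˇ`; in particular `ωˇ = ω`.
-/

open scoped ComplexOrder

noncomputable section

namespace HypergroupTheory

section ComplexMeasure

variable {X : Type*} [MeasurableSpace X]

theorem integral_congr_transpose {E F F' G : Type*} [NormedAddCommGroup E] [NormedSpace ℝ E]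
    [NormedAddCommGroup F] [NormedSpace ℝ F] [NormedAddCommGroup F'] [NormedSpace ℝ F']
    [NormedAddCommGroup G] [NormedSpace ℝ G] {μ : VectorMeasure X F} {ν : VectorMeasure X F'}
    {B : E →L[ℝ] F →L[ℝ] G} {C : E →L[ℝ] F' →L[ℝ] G} {f : X → E}
    (h : μ.transpose B = ν.transpose C) (hμ : μ.Integrable f) (hν : ν.Integrable f) :
    μ.integral f B = ν.integral f C := by
  simp only [VectorMeasure.integral_eq_setToFun_transpose, hμ, hν, h]

theorem integral_complex_smul {μ : ComplexMeasure X} {f : X → ℂ} (hf : μ.Integrable f) (c : ℂ) :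
    (c • μ).integral f (ContinuousLinearMap.mul ℝ ℂ) =
      c * μ.integral f (ContinuousLinearMap.mul ℝ ℂ) := by
  have hcf : (c • μ).Integrable f := by
    rw [VectorMeasure.Integrable, VectorMeasure.variation_smul]
    exact hf.smul_measure_nnreal
  have htranspose : (c • μ).transpose (ContinuousLinearMap.mul ℝ ℂ) =
      μ.transpose (ContinuousLinearMap.compL ℝ ℂ ℂ ℂ (ContinuousLinearMap.mul ℝ ℂ c) ∘L
        ContinuousLinearMap.mul ℝ ℂ) := by
    ext s
    change _ * (c * μ s) = c * (_ * μ s)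
    ring
  rw [integral_congr_transpose htranspose hcf hf]
  exact (VectorMeasure.continuousLinearMap_apply_integral hf).symm

theorem variation_eq_of_forall_eq_real {μ : ComplexMeasure X} {P : Measure X} [IsFiniteMeasure P]
    (h : ∀ A, MeasurableSet A → μ A = P.real A) : μ.variation = P := by
  have henorm : ∀ A, MeasurableSet A → ‖μ A‖ₑ = P A := fun A hA => by
    rw [h A hA, ← ofReal_norm, Complex.norm_real, Real.norm_of_nonneg measureReal_nonneg,
      ofReal_measureReal]
  refine le_antisymm
    (VectorMeasure.variation_le_of_forall_enorm_le fun A hA => (henorm A hA).le) ?_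
  exact Measure.le_iff.2 fun A hA =>
    (henorm A hA).symm.trans_le (VectorMeasure.enorm_measure_le_variation _ _)

theorem exists_forall_eq_real_of_nonneg {μ : ComplexMeasure X}
    (h : ∀ A, MeasurableSet A → 0 ≤ μ A) :
    ∃ P : Measure X, IsFiniteMeasure P ∧ ∀ A, MeasurableSet A → μ A = P.real A := by
  have hre : 0 ≤[univ] ComplexMeasure.re μ := (VectorMeasure.le_restrict_univ_iff_le _ _).2
    (VectorMeasure.le_iff.2 fun A hA => (Complex.nonneg_iff.1 (h A hA)).1)
  refine ⟨(ComplexMeasure.re μ).toMeasureOfZeroLE univ .univ hre, inferInstance, fun A hA => ?_⟩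
  rw [SignedMeasure.toMeasureOfZeroLE_real_apply _ _ _ hA, univ_inter]
  exact Complex.eq_re_of_ofReal_le (h A hA)

end ComplexMeasure

instance completelyRegularSpace_of_locallyCompactSpace {X : Type*} [TopologicalSpace X]
    [LocallyCompactSpace X] [RegularSpace X] : CompletelyRegularSpace X where
  completely_regular x C hC hx := by
    obtain ⟨g, hgx, hgC, hg⟩ := exists_continuous_zero_one_of_isCompact
      (isCompact_singleton (x := x)) hC (disjoint_singleton_left.2 hx)
    exact ⟨fun y => ⟨g y, hg y⟩, g.continuous.subtype_mk hg, Subtype.ext (hgx rfl),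
      fun y hy => Subtype.ext (hgC hy)⟩

theorem exists_nonneg_eqOn_zero_of_isClosed {X : Type*} [TopologicalSpace X]
    [CompletelyRegularSpace X] {C : Set X} (hC : IsClosed C) {z : X} (hz : z ∉ C) :
    ∃ f : X →ᵇ ℂ, 0 ≤ (f : X → ℂ) ∧ EqOn f 0 C ∧ f z ≠ 0 := by
  obtain ⟨g, hg, hgz, hgC⟩ := CompletelyRegularSpace.completely_regular z C hC hz
  refine ⟨.ofNormedAddCommGroup (fun x => ((1 - g x : ℝ) : ℂ)) (by fun_prop) 1 fun x => ?_,
    fun x => ?_, fun x hx => ?_, ?_⟩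
  · rw [Complex.norm_real, Real.norm_of_nonneg (unitInterval.one_minus_nonneg _)]
    exact unitInterval.one_minus_le_one _
  · exact Complex.zero_le_real.2 (unitInterval.one_minus_nonneg _)
  · simp [hgC hx]
  · simp [hgz]

theorem mem_closure_iff_forall_nonneg {X : Type*} [TopologicalSpace X] [CompletelyRegularSpace X]
    {S : Set X} {z : X} :
    z ∈ closure S ↔ ∀ f : X →ᵇ ℂ, 0 ≤ (f : X → ℂ) → EqOn f 0 S → f z = 0 := by
  refine ⟨fun hz f _ hf => hf.closure f.continuous continuous_zero hz, fun h => ?_⟩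
  by_contra hz
  obtain ⟨f, hf, hfS, hfz⟩ := exists_nonneg_eqOn_zero_of_isClosed isClosed_closure hz
  exact hfz (h f hf (hfS.mono subset_closure))

theorem exists_nonneg_lintegral_edist_indicator_le {X : Type*} [TopologicalSpace X]
    [LocallyCompactSpace X] [T2Space X] [MeasurableSpace X] [BorelSpace X] (μ : Measure X)
    [IsFiniteMeasure μ] [μ.Regular] {A : Set X} (hA : MeasurableSet A) {ε : ℝ≥0∞} (hε : ε ≠ 0) :
    ∃ f : X →ᵇ ℂ, 0 ≤ (f : X → ℂ) ∧ ∫⁻ x, edist (A.indicator 1 x) (f x) ∂μ ≤ ε := by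
  have hε2 : ε / 2 ≠ 0 := by simpa using hε
  obtain ⟨C, hCA, hC, hAC⟩ := hA.exists_isCompact_sdiff_lt (measure_ne_top μ A) hε2
  obtain ⟨U, hCU, hU, -, hUC⟩ :=
    hC.measurableSet.exists_isOpen_sdiff_lt (measure_ne_top μ C) hε2
  obtain ⟨g, hgC, hgU, -, hg⟩ := exists_continuous_one_zero_of_isCompact hC hU.isClosed_compl
    (disjoint_compl_right_iff_subset.2 hCU)
  refine ⟨.ofNormedAddCommGroup (fun x => (g x : ℂ)) (by fun_prop) 1 fun x => ?_,
    fun x => Complex.zero_le_real.2 (hg x).1, ?_⟩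
  · rw [Complex.norm_real, Real.norm_of_nonneg (hg x).1]
    exact (hg x).2
  have hbound : ∀ x, edist (A.indicator 1 x) (g x : ℂ) ≤ (A \ C ∪ U \ C).indicator 1 x := by
    intro x
    have hle : ∀ r ∈ Icc (0 : ℝ) 1, edist (r : ℂ) (g x : ℂ) ≤ 1 := fun r hr => by
      rw [edist_dist, Complex.isometry_ofReal.dist_eq]
      exact ENNReal.ofReal_le_one.2 (Real.dist_le_of_mem_Icc_01 hr (hg x))
    have hle_zero := hle 0 (by simp)
    have hle_one := hle 1 (by simp)
    by_cases hxC : x ∈ C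
    · simp [hCA hxC, hgC hxC]
    by_cases hxU : x ∈ U
    · by_cases hxA : x ∈ A <;> simp_all
    · have hgx : g x = 0 := hgU hxU
      by_cases hxA : x ∈ A <;> simp_all
  calc ∫⁻ x, edist (A.indicator 1 x) (g x : ℂ) ∂μ
      ≤ ∫⁻ x, (A \ C ∪ U \ C).indicator 1 x ∂μ := lintegral_mono hbound
    _ ≤ μ (A \ C ∪ U \ C) := lintegral_indicator_one_le _
    _ ≤ μ (A \ C) + μ (U \ C) := measure_union_le _ _
    _ ≤ ε / 2 + ε / 2 := add_le_add hAC.le hUC.le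
    _ = ε := ENNReal.add_halves ε

theorem exists_eq_of_isWeak {𝕜 E F : Type*} [NontriviallyNormedField 𝕜] [AddCommGroup E]
    [Module 𝕜 E] [AddCommGroup F] [Module 𝕜 F] [TopologicalSpace E] (B : E →ₗ[𝕜] F →ₗ[𝕜] 𝕜)
    [hB : B.IsWeak] (φ : E →L[𝕜] 𝕜) : ∃ y, ∀ x, φ x = B x y := by
  obtain rfl := hB.eq_induced
  obtain ⟨y, hy⟩ := LinearMap.dualEmbedding_surjective B φ
  exact ⟨y, fun x => (DFunLike.congr_fun hy x).symm⟩

section Pairing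

variable {K : Type*} [TopologicalSpace K] [MeasurableSpace K] [BorelSpace K] [T2Space K]

instance isFiniteMeasure_variation (μ : boundedRegularMeasures K) :
    IsFiniteMeasure (μ : ComplexMeasure K).variation := μ.2.1

instance regular_variation (μ : boundedRegularMeasures K) :
    (μ : ComplexMeasure K).variation.Regular := μ.2.2

theorem integrable_boundedContinuousFunction (μ : boundedRegularMeasures K) (f : K →ᵇ ℂ) :
    (μ : ComplexMeasure K).Integrable f :=
  f.integrable _

/-- The pairing of `M(K)` with the bounded continuous functions as a bilinear map. -/
def pairingₗ : boundedRegularMeasures K →ₗ[ℂ] (K →ᵇ ℂ) →ₗ[ℂ] ℂ :=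
  LinearMap.mk₂ ℂ pairing
    (fun μ ν f => VectorMeasure.integral_add_vectorMeasure
      (integrable_boundedContinuousFunction μ f) (integrable_boundedContinuousFunction ν f))
    (fun c μ f => integral_complex_smul (integrable_boundedContinuousFunction μ f) c)
    (fun μ f g => VectorMeasure.integral_add
      (integrable_boundedContinuousFunction μ f) (integrable_boundedContinuousFunction μ g))
    (fun c μ f => setToFun_smul (𝕜 := ℂ) _
      (fun c s x => by simp [VectorMeasure.transpose, mul_left_comm]) c f)

theorem pairingₗ_apply (μ : boundedRegularMeasures K) (f : K →ᵇ ℂ) :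
    pairingₗ μ f = pairing μ f := rfl

theorem pairing_delta (x : K) (f : K →ᵇ ℂ) : pairing (delta x) f = f x := by
  simp [pairing, delta]

theorem pairing_one_eq_apply_univ (μ : boundedRegularMeasures K) :
    pairing μ 1 = (μ : ComplexMeasure K) univ :=
  (VectorMeasure.integral_const (1 : ℂ)).trans (one_mul _)

theorem pairing_congr {μ : boundedRegularMeasures K} {f g : K →ᵇ ℂ} (h : EqOn f g (supp μ)) :
    pairing μ f = pairing μ g := by
  refine VectorMeasure.integral_congr_ae ?_
  filter_upwards [Measure.support_mem_ae_of_regular (μ := (μ : ComplexMeasure K).variation)]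
    using h

instance isWeak_pairingₗ : (pairingₗ (K := K)).IsWeak := ⟨rfl⟩

/-- Integration of `f` as a weakly continuous functional on `M(K)`. -/
def pairingCLM (f : K →ᵇ ℂ) : boundedRegularMeasures K →L[ℂ] ℂ :=
  LinearMap.IsWeak.eval pairingₗ f

theorem pairingCLM_apply (f : K →ᵇ ℂ) (μ : boundedRegularMeasures K) :
    pairingCLM f μ = pairing μ f := rfl

theorem exists_forall_eq_pairing (φ : boundedRegularMeasures K →L[ℂ] ℂ) :
    ∃ g : K →ᵇ ℂ, ∀ μ, φ μ = pairing μ g :=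
  exists_eq_of_isWeak (E := boundedRegularMeasures K) pairingₗ φ

/-- The bounded continuous function `x ↦ φ δ_x` that represents a weakly continuous functional `φ`.
Since `M(K)` is in duality with the bounded continuous functions, `φ` is integration of it; applied
to `φ μ = ⟨μ * ν, f⟩` this replaces Fubini's theorem. -/
def representative (φ : boundedRegularMeasures K →L[ℂ] ℂ) : K →ᵇ ℂ :=
  (exists_forall_eq_pairing φ).choose

theorem pairing_representative (φ : boundedRegularMeasures K →L[ℂ] ℂ)
    (μ : boundedRegularMeasures K) : pairing μ (representative φ) = φ μ :=
  ((exists_forall_eq_pairing φ).choose_spec μ).symm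

theorem representative_apply (φ : boundedRegularMeasures K →L[ℂ] ℂ) (x : K) :
    representative φ x = φ (delta x) := by
  rw [← pairing_delta, pairing_representative]

theorem apply_eq_mul_pairing_one {φ : boundedRegularMeasures K →L[ℂ] ℂ} {c : ℂ}
    {μ : boundedRegularMeasures K} (h : ∀ x ∈ supp μ, φ (delta x) = c) :
    φ μ = c * pairing μ 1 := by
  have hconst : EqOn (representative φ) (c • 1 : K →ᵇ ℂ) (supp μ) := fun x hx => by
    simp [representative_apply, h x hx]
  rw [← pairing_representative, pairing_congr hconst, ← pairingₗ_apply, map_smul, smul_eq_mul,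
    pairingₗ_apply]

theorem ext_delta {φ ψ : boundedRegularMeasures K →L[ℂ] ℂ}
    (h : ∀ x, φ (delta x) = ψ (delta x)) : φ = ψ := by
  have hrepresentative : representative φ = representative ψ := by
    ext x
    simp only [representative_apply, h]
  ext μ
  rw [← pairing_representative, hrepresentative, pairing_representative]

theorem apply_mem_closure_pairing_nonneg [LocallyCompactSpace K] (ρ : boundedRegularMeasures K)
    {A : Set K} (hA : MeasurableSet A) :
    (ρ : ComplexMeasure K) A ∈ closure (pairing ρ '' {f | 0 ≤ (f : K → ℂ)}) := by
  refine EMetric.mem_closure_iff.2 fun ε hε => ?_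
  obtain ⟨δ, hδ, hδε⟩ := exists_between hε
  obtain ⟨f, hf, hfA⟩ :=
    exists_nonneg_lintegral_edist_indicator_le (ρ : ComplexMeasure K).variation hA hδ.ne'
  refine ⟨pairing ρ f, mem_image_of_mem _ hf, lt_of_le_of_lt ?_ hδε⟩
  have hindicator : (ρ : ComplexMeasure K).Integrable (A.indicator 1) :=
    (integrable_const (1 : ℂ)).indicator hA
  have happly : (ρ : ComplexMeasure K).integral (A.indicator 1) (ContinuousLinearMap.mul ℝ ℂ) =
      (ρ : ComplexMeasure K) A := by
    refine (VectorMeasure.integral_indicator_const (1 : ℂ) hA).trans ?_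
    rw [ContinuousLinearMap.mul_apply', one_mul]
  calc edist ((ρ : ComplexMeasure K) A) (pairing ρ f)
      ≤ ∫⁻ x, edist (A.indicator 1 x) (f x) ∂(ρ : ComplexMeasure K).variation := by
        simpa only [ContinuousLinearMap.opENorm_mul, one_mul, happly] using!
          VectorMeasure.edist_integral_le_lintegral_edist (B := ContinuousLinearMap.mul ℝ ℂ)
            hindicator (integrable_boundedContinuousFunction ρ f)
    _ ≤ δ := hfA

theorem ext_pairing [LocallyCompactSpace K] {μ ν : boundedRegularMeasures K}
    (h : ∀ f, pairing μ f = pairing ν f) : μ = ν := by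
  rw [← sub_eq_zero]
  have hzero : ∀ f, pairing (μ - ν) f = 0 := fun f =>
    (map_sub (pairingCLM f) μ ν).trans (sub_eq_zero.2 (h f))
  ext A hA
  have hsubset : pairing (μ - ν) '' {f | 0 ≤ (f : K → ℂ)} ⊆ {0} :=
    image_subset_iff.2 fun f _ => hzero f
  simpa using closure_mono hsubset (apply_mem_closure_pairing_nonneg (μ - ν) hA)

theorem ext_delta_map {L : Type*} [TopologicalSpace L] [MeasurableSpace L] [BorelSpace L]
    [T2Space L] [LocallyCompactSpace L]
    {S T : boundedRegularMeasures K →L[ℂ] boundedRegularMeasures L}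
    (h : ∀ x, S (delta x) = T (delta x)) : S = T := by
  ext1 μ
  refine ext_pairing fun f => ?_
  have hcomp : (pairingCLM f).comp S = (pairingCLM f).comp T :=
    ext_delta fun x => congrArg (pairingCLM f) (h x)
  exact DFunLike.congr_fun hcomp μ

theorem map_eq_pairing_one_smul {L : Type*} [TopologicalSpace L] [MeasurableSpace L] [BorelSpace L]
    [T2Space L] [LocallyCompactSpace L]
    {T : boundedRegularMeasures K →L[ℂ] boundedRegularMeasures L} {μ : boundedRegularMeasures K}
    {ν : boundedRegularMeasures L}
    (h : ∀ x ∈ supp μ, T (delta x) = ν) : T μ = pairing μ 1 • ν := by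
  refine ext_pairing fun f => ?_
  have happly : (pairingCLM f).comp T μ = pairing ν f * pairing μ 1 :=
    apply_eq_mul_pairing_one fun x hx => congrArg (pairingCLM f) (h x hx)
  exact happly.trans ((mul_comm _ _).trans ((pairingCLM f).map_smul _ _).symm)

end Pairing

section Probability

variable {K : Type*} [TopologicalSpace K] [MeasurableSpace K] [BorelSpace K] [T2Space K]

theorem isProbability_delta (x : K) : IsProbability (delta x) :=
  ⟨Measure.dirac x, inferInstance, fun A hA => by
    by_cases hx : x ∈ A <;> simp [delta, Measure.real, hA, hx]⟩

namespace IsProbability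

variable {μ : boundedRegularMeasures K}

theorem isProbabilityMeasure (hμ : IsProbability μ) :
    IsProbabilityMeasure (μ : ComplexMeasure K).variation := by
  obtain ⟨P, hP, h⟩ := hμ
  rwa [variation_eq_of_forall_eq_real h]

theorem pairing_eq_integral (hμ : IsProbability μ) (f : K →ᵇ ℂ) :
    pairing μ f = ∫ x, f x ∂(μ : ComplexMeasure K).variation := by
  obtain ⟨P, hP, h⟩ := hμ
  rw [pairing, VectorMeasure.integral_eq_setToFun, MeasureTheory.integral_eq_setToFun]
  refine setToFun_congr_left' _ _ (fun s hs _ => ?_) _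
  ext
  simp [VectorMeasure.transpose, weightedSMul, h s hs, variation_eq_of_forall_eq_real h]

theorem pairing_one (hμ : IsProbability μ) : pairing μ 1 = 1 := by
  have := hμ.isProbabilityMeasure
  simp [hμ.pairing_eq_integral]

theorem pairing_star (hμ : IsProbability μ) (f : K →ᵇ ℂ) :
    pairing μ (star f) = star (pairing μ f) := by
  simp only [hμ.pairing_eq_integral]
  exact integral_conj

theorem pairing_nonneg (hμ : IsProbability μ) {f : K →ᵇ ℂ} (hf : 0 ≤ (f : K → ℂ)) :
    0 ≤ pairing μ f := by
  rw [hμ.pairing_eq_integral]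
  exact integral_nonneg hf

theorem pairing_eq_zero_iff (hμ : IsProbability μ) {f : K →ᵇ ℂ} (hf : 0 ≤ (f : K → ℂ)) :
    pairing μ f = 0 ↔ EqOn f 0 (supp μ) := by
  refine ⟨fun h0 x hx => ?_, fun h0 => (pairing_congr h0).trans (map_zero (pairingₗ μ))⟩
  rw [hμ.pairing_eq_integral] at h0
  have hre : ∀ y, ((f y).re : ℂ) = f y := fun y => (Complex.eq_re_of_ofReal_le (hf y)).symm
  have hintegral : ∫ y, (f y).re ∂(μ : ComplexMeasure K).variation = 0 := by
    rw [← Complex.ofReal_eq_zero, ← integral_complex_ofReal, ← h0]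
    exact integral_congr_ae (.of_forall hre)
  have hae := (integral_eq_zero_iff_of_nonneg (fun y => (Complex.nonneg_iff.1 (hf y)).1)
    (f.integrable _).re).1 hintegral
  have hae' : ∀ᵐ y ∂(μ : ComplexMeasure K).variation, f y = 0 := by
    filter_upwards [hae] with y hy
    rw [← hre y, show (f y).re = 0 from hy, Complex.ofReal_zero]
  by_contra hne
  exact ((Measure.mem_support_iff_forall x).1 hx _
    ((isOpen_ne.preimage f.continuous).mem_nhds hne)).ne' hae'

theorem supp_nonempty (hμ : IsProbability μ) : (supp μ).Nonempty := by
  by_contra! hempty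
  have hone : EqOn (1 : K →ᵇ ℂ) 0 (supp μ) := by simp [hempty]
  exact one_ne_zero (hμ.pairing_one.symm.trans
    ((hμ.pairing_eq_zero_iff fun _ => zero_le_one).2 hone))

theorem apply_nonneg (hμ : IsProbability μ) {φ : boundedRegularMeasures K →L[ℂ] ℂ}
    (hφ : ∀ x, 0 ≤ φ (delta x)) : 0 ≤ φ μ := by
  rw [← pairing_representative]
  exact hμ.pairing_nonneg fun x => (hφ x).trans_eq (representative_apply φ x).symm

theorem apply_eq_zero_iff (hμ : IsProbability μ) {φ : boundedRegularMeasures K →L[ℂ] ℂ}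
    (hφ : ∀ x, 0 ≤ φ (delta x)) : φ μ = 0 ↔ ∀ x ∈ supp μ, φ (delta x) = 0 := by
  simp only [← representative_apply] at hφ ⊢
  rw [← pairing_representative]
  exact hμ.pairing_eq_zero_iff hφ

theorem pairing_sub_mul_star (hμ : IsProbability μ) (f : K →ᵇ ℂ) :
    pairing μ ((f - pairing μ f • 1) * star (f - pairing μ f • 1)) =
      pairing μ (f * star f) - pairing μ f * star (pairing μ f) := by
  set c := pairing μ f with hc
  have hexpand : (f - c • 1) * star (f - c • 1) =
      f * star f - star c • f - c • star f + (c * star c) • 1 := by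
    ext x
    simp only [BoundedContinuousFunction.coe_mul, BoundedContinuousFunction.coe_sub,
      BoundedContinuousFunction.coe_add, BoundedContinuousFunction.coe_star,
      BoundedContinuousFunction.coe_smul, BoundedContinuousFunction.coe_one, Pi.mul_apply,
      Pi.sub_apply, Pi.add_apply, Pi.star_apply, Pi.one_apply, star_sub, smul_eq_mul, mul_one]
    ring
  rw [hexpand, ← pairingₗ_apply]
  simp only [map_add, map_sub, map_smul, pairingₗ_apply, hμ.pairing_star, hμ.pairing_one, ← hc,
    smul_eq_mul]
  ring

theorem mul_star_pairing_le (hμ : IsProbability μ) (f : K →ᵇ ℂ) :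
    pairing μ f * star (pairing μ f) ≤ pairing μ (f * star f) := by
  rw [← sub_nonneg, ← hμ.pairing_sub_mul_star]
  exact hμ.pairing_nonneg fun x => mul_star_self_nonneg _

theorem eqOn_const_of_pairing_mul_star_eq (hμ : IsProbability μ) {f : K →ᵇ ℂ}
    (h : pairing μ (f * star f) = pairing μ f * star (pairing μ f)) :
    EqOn f (fun _ => pairing μ f) (supp μ) := by
  intro x hx
  rw [← sub_eq_zero, ← hμ.pairing_sub_mul_star,
    hμ.pairing_eq_zero_iff fun x => mul_star_self_nonneg _] at h
  simpa [sub_eq_zero, (starRingEnd ℂ).injective.eq_iff] using h hx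

end IsProbability

theorem isClosed_supp (μ : boundedRegularMeasures K) : IsClosed (supp μ) :=
  Measure.isClosed_support

theorem isProbability_iff [LocallyCompactSpace K] {μ : boundedRegularMeasures K} :
    IsProbability μ ↔ (∀ f : K →ᵇ ℂ, 0 ≤ (f : K → ℂ) → 0 ≤ pairing μ f) ∧ pairing μ 1 = 1 := by
  refine ⟨fun hμ => ⟨fun f => hμ.pairing_nonneg, hμ.pairing_one⟩, fun ⟨hpos, hone⟩ => ?_⟩
  have hsubset : pairing μ '' {f | 0 ≤ (f : K → ℂ)} ⊆ Ici 0 := image_subset_iff.2 hpos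
  have hnonneg : ∀ A, MeasurableSet A → 0 ≤ (μ : ComplexMeasure K) A := fun A hA =>
    closure_minimal hsubset isClosed_Ici (apply_mem_closure_pairing_nonneg μ hA)
  obtain ⟨P, hP, hμP⟩ := exists_forall_eq_real_of_nonneg hnonneg
  refine ⟨P, isProbabilityMeasure_iff_real.2 ?_, hμP⟩
  rwa [pairing_one_eq_apply_univ, hμP _ .univ, Complex.ofReal_eq_one] at hone

theorem IsProbability.supp_eq_closure [CompletelyRegularSpace K]
    {μ : boundedRegularMeasures K} (hμ : IsProbability μ) {S : Set K}
    (h : ∀ f : K →ᵇ ℂ, 0 ≤ (f : K → ℂ) → (pairing μ f = 0 ↔ EqOn f 0 S)) :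
    supp μ = closure S := by
  rw [← (isClosed_supp μ).closure_eq]
  ext z
  rw [mem_closure_iff_forall_nonneg, mem_closure_iff_forall_nonneg]
  exact forall₂_congr fun f hf => by rw [← hμ.pairing_eq_zero_iff hf, h f hf]

theorem supp_delta [CompletelyRegularSpace K] (x : K) : supp (delta x) = {x} := by
  rw [← closure_singleton]
  exact (isProbability_delta x).supp_eq_closure fun f _ => by simp [pairing_delta]

end Probability

section Map

variable {K L : Type*} [TopologicalSpace K] [MeasurableSpace K] [BorelSpace K] [T2Space K]
  [TopologicalSpace L] [MeasurableSpace L] [BorelSpace L] [T2Space L]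

/-- The image of bounded regular measures under a homeomorphism, as a linear map. -/
def mapHomeomorphₗ (φ : K ≃ₜ L) : boundedRegularMeasures K →ₗ[ℂ] boundedRegularMeasures L where
  toFun μ := ⟨VectorMeasure.map (μ : ComplexMeasure K) φ, by
    change IsFiniteMeasure _ ∧ Measure.Regular _
    rw [φ.measurableEmbedding.variation_map]
    exact ⟨inferInstance, Measure.Regular.map φ⟩⟩
  map_add' μ ν := Subtype.ext (VectorMeasure.map_add _ _ φ)
  map_smul' c μ := Subtype.ext (VectorMeasure.map_smul c)

theorem pairing_mapHomeomorphₗ (φ : K ≃ₜ L) (μ : boundedRegularMeasures K) (f : L →ᵇ ℂ) :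
    pairing (mapHomeomorphₗ φ μ) f = pairing μ (f.compContinuous φ) :=
  φ.measurableEmbedding.integral_map_vectorMeasure

/-- The image of bounded regular measures under a homeomorphism, as a weakly continuous map. -/
def mapHomeomorph (φ : K ≃ₜ L) : boundedRegularMeasures K →L[ℂ] boundedRegularMeasures L where
  toLinearMap := mapHomeomorphₗ φ
  cont := continuous_induced_rng.2 <| continuous_pi fun f => by
    have hcont : Continuous fun μ : boundedRegularMeasures K => pairing (mapHomeomorphₗ φ μ) f := by
      simp only [pairing_mapHomeomorphₗ]
      exact (pairingCLM (f.compContinuous (φ : C(K, L)))).continuous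
    exact hcont

theorem pairing_mapHomeomorph (φ : K ≃ₜ L) (μ : boundedRegularMeasures K) (f : L →ᵇ ℂ) :
    pairing (mapHomeomorph φ μ) f = pairing μ (f.compContinuous φ) :=
  pairing_mapHomeomorphₗ φ μ f

theorem mapHomeomorph_delta [LocallyCompactSpace L] (φ : K ≃ₜ L) (x : K) :
    mapHomeomorph φ (delta x) = delta (φ x) :=
  ext_pairing fun f => by
    rw [pairing_mapHomeomorph, pairing_delta, pairing_delta]
    rfl

theorem IsProbability.mapHomeomorph {μ : boundedRegularMeasures K} (hμ : IsProbability μ)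
    (φ : K ≃ₜ L) : IsProbability (mapHomeomorph φ μ) := by
  obtain ⟨P, hP, h⟩ := hμ
  refine ⟨P.map φ, Measure.isProbabilityMeasure_map φ.measurable.aemeasurable, fun A hA => ?_⟩
  rw [map_measureReal_apply φ.measurable hA, ← h _ (φ.measurable hA)]
  exact VectorMeasure.map_apply _ φ.measurable hA

theorem IsProbability.supp_mapHomeomorph [CompletelyRegularSpace L] {μ : boundedRegularMeasures K}
    (hμ : IsProbability μ) (φ : K ≃ₜ L) :
    supp (HypergroupTheory.mapHomeomorph φ μ) = φ '' supp μ := by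
  rw [← (φ.isClosedMap _ (isClosed_supp μ)).closure_eq]
  refine (hμ.mapHomeomorph φ).supp_eq_closure fun f hf => ?_
  rw [pairing_mapHomeomorph, hμ.pairing_eq_zero_iff fun x => hf (φ x)]
  exact (forall_mem_image (p := fun y => f y = 0)).symm

end Map

namespace Hypergroup

variable {K : Type*} [TopologicalSpace K] [LocallyCompactSpace K] [T2Space K]
  [MeasurableSpace K] [BorelSpace K] (H : Hypergroup K)

/-- Convolution by `μ` from the left, `ν ↦ μ * ν`, as a weakly continuous operator on `M(K)`. -/
def convLeft (μ : boundedRegularMeasures K) :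
    boundedRegularMeasures K →L[ℂ] boundedRegularMeasures K :=
  ⟨H.conv μ, H.continuous_conv_left μ⟩

theorem convLeft_apply (μ ν : boundedRegularMeasures K) : H.convLeft μ ν = H.conv μ ν := rfl

/-- Convolution by `ν` from the right, `μ ↦ μ * ν`, as a weakly continuous operator on `M(K)`. -/
def convRight (ν : boundedRegularMeasures K) :
    boundedRegularMeasures K →L[ℂ] boundedRegularMeasures K :=
  ⟨H.conv.flip ν, H.continuous_conv_right ν⟩

theorem convRight_apply (μ ν : boundedRegularMeasures K) : H.convRight ν μ = H.conv μ ν := rfl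

theorem delta_e_conv (μ : boundedRegularMeasures K) : H.conv (delta H.e) μ = μ := by
  have hid : H.convLeft (delta H.e) = .id ℂ _ := ext_delta_map H.e_conv
  exact DFunLike.congr_fun hid μ

theorem conv_eq_smul_of_forall_delta_conv_eq {μ ν : boundedRegularMeasures K}
    (h : ∀ x ∈ supp ν, H.conv (delta x) μ = μ) : H.conv ν μ = pairing ν 1 • μ :=
  map_eq_pairing_one_smul (T := H.convRight μ) h

theorem conv_eq_smul_of_forall_conv_delta_eq {μ ν : boundedRegularMeasures K}
    (h : ∀ x ∈ supp ν, H.conv μ (delta x) = μ) : H.conv μ ν = pairing ν 1 • μ :=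
  map_eq_pairing_one_smul (T := H.convLeft μ) h

theorem isProbability_conv {μ ν : boundedRegularMeasures K} (hμ : IsProbability μ)
    (hν : IsProbability ν) : IsProbability (H.conv μ ν) := by
  refine isProbability_iff.2 ⟨fun f hf => ?_, ?_⟩
  · exact hμ.apply_nonneg (φ := (pairingCLM f).comp (H.convRight ν)) fun x =>
      hν.apply_nonneg (φ := (pairingCLM f).comp (H.convLeft (delta x))) fun y =>
        (H.isProbability_conv_delta x y).pairing_nonneg hf
  · have hdelta : ∀ x, pairing (H.conv (delta x) ν) 1 = 1 := fun x => by
      have hxν := apply_eq_mul_pairing_one (φ := pairingCLM 1 ∘L H.convLeft (delta x)) (μ := ν)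
        fun y _ => (H.isProbability_conv_delta x y).pairing_one
      rwa [hν.pairing_one, mul_one] at hxν
    have hμν := apply_eq_mul_pairing_one (φ := pairingCLM 1 ∘L H.convRight ν) (μ := μ)
      fun x _ => hdelta x
    rwa [hμ.pairing_one, mul_one] at hμν

theorem mem_setMul {A B : Set K} {z : K} :
    z ∈ H.setMul A B ↔ ∃ x ∈ A, ∃ y ∈ B, z ∈ supp (H.conv (delta x) (delta y)) := by
  simp only [setMul, mem_iUnion, exists_prop]

theorem pairing_conv_eq_zero_iff {μ ν : boundedRegularMeasures K} (hμ : IsProbability μ)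
    (hν : IsProbability ν) {f : K →ᵇ ℂ} (hf : 0 ≤ (f : K → ℂ)) :
    pairing (H.conv μ ν) f = 0 ↔ EqOn f 0 (H.setMul (supp μ) (supp ν)) := by
  have hleft := hμ.apply_eq_zero_iff (φ := (pairingCLM f).comp (H.convRight ν)) fun x =>
    (H.isProbability_conv (isProbability_delta x) hν).pairing_nonneg hf
  have hright : ∀ x, _ := fun x =>
    hν.apply_eq_zero_iff (φ := (pairingCLM f).comp (H.convLeft (delta x))) fun y =>
      (H.isProbability_conv_delta x y).pairing_nonneg hf
  simp only [ContinuousLinearMap.comp_apply, convLeft_apply, convRight_apply, pairingCLM_apply]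
    at hleft hright
  simp only [hleft, hright, (H.isProbability_conv_delta _ _).pairing_eq_zero_iff hf, EqOn,
    mem_setMul]
  exact ⟨fun h z ⟨x, hx, y, hy, hz⟩ => h x hx y hy hz,
    fun h x hx y hy z hz => h ⟨x, hx, y, hy, hz⟩⟩

theorem supp_conv {μ ν : boundedRegularMeasures K} (hμ : IsProbability μ)
    (hν : IsProbability ν) : supp (H.conv μ ν) = closure (H.setMul (supp μ) (supp ν)) :=
  (H.isProbability_conv hμ hν).supp_eq_closure fun _ => H.pairing_conv_eq_zero_iff hμ hν

theorem isCompact_supp_conv_delta (x y : K) : IsCompact (supp (H.conv (delta x) (delta y))) := by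
  obtain ⟨S, -, hS⟩ := H.continuous_supp
  exact hS x y ▸ (S (x, y)).isCompact

theorem isCompact_setMul {A B : Set K} (hA : IsCompact A) (hB : IsCompact B) :
    IsCompact (H.setMul A B) := by
  obtain ⟨S, hS, hSsupp⟩ := H.continuous_supp
  have hunion : H.setMul A B = ⋃ C ∈ S '' (A ×ˢ B), (C : Set K) := by
    simp only [setMul, biUnion_image, biUnion_prod', hSsupp]
  rw [hunion]
  exact TopologicalSpace.NonemptyCompacts.isCompact_biUnion_coe_of_isCompact
    ((hA.prod hB).image hS)

/-- The involution `x ↦ xˇ` as a homeomorphism. -/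
def invHomeomorph : K ≃ₜ K where
  toFun := H.inv
  invFun := H.inv
  left_inv := H.inv_inv
  right_inv := H.inv_inv
  continuous_toFun := H.continuous_inv
  continuous_invFun := H.continuous_inv

/-- The reflection `μ ↦ μˇ` of measures, as a weakly continuous operator on `M(K)`. -/
def mapInv : boundedRegularMeasures K →L[ℂ] boundedRegularMeasures K :=
  mapHomeomorph H.invHomeomorph

theorem mapInv_delta (x : K) : H.mapInv (delta x) = delta (H.inv x) :=
  mapHomeomorph_delta H.invHomeomorph x

theorem mapInv_conv (μ ν : boundedRegularMeasures K) :
    H.mapInv (H.conv μ ν) = H.conv (H.mapInv ν) (H.mapInv μ) := by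
  have hdelta : ∀ y, H.mapInv ∘L H.convRight (delta y) =
      H.convLeft (delta (H.inv y)) ∘L H.mapInv := fun y => ext_delta_map fun x => by
    simp only [ContinuousLinearMap.comp_apply, mapInv_delta]
    exact Subtype.ext (H.map_inv_conv x y)
  have hμ : H.mapInv ∘L H.convLeft μ = H.convRight (H.mapInv μ) ∘L H.mapInv :=
    ext_delta_map fun y => by
      simp only [ContinuousLinearMap.comp_apply, mapInv_delta]
      exact DFunLike.congr_fun (hdelta y) μ
  exact DFunLike.congr_fun hμ ν

theorem inv_mem_supp_conv_delta {x y t : K} (ht : t ∈ supp (H.conv (delta x) (delta y))) :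
    H.inv t ∈ supp (H.conv (delta (H.inv y)) (delta (H.inv x))) := by
  rw [← mapInv_delta, ← mapInv_delta, ← mapInv_conv, mapInv,
    (H.isProbability_conv_delta x y).supp_mapHomeomorph]
  exact mem_image_of_mem _ ht

theorem e_mem_supp_conv_delta_inv (x : K) : H.e ∈ supp (H.conv (delta x) (delta (H.inv x))) :=
  (H.e_mem_supp_iff _ _).2 (H.inv_inv x).symm

-- The support of `δ_x * δ_yˇ * δ_tˇ` contains `e`; associated to the right, this says that
-- `xˇ ∈ supp (δ_yˇ * δ_tˇ)`.
theorem mem_supp_conv_delta_of_mem_supp_conv_delta_inv {x y t : K}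
    (ht : t ∈ supp (H.conv (delta x) (delta (H.inv y)))) :
    x ∈ supp (H.conv (delta t) (delta y)) := by
  have he : H.e ∈ supp (H.conv (H.conv (delta x) (delta (H.inv y))) (delta (H.inv t))) := by
    rw [H.supp_conv (H.isProbability_conv_delta _ _) (isProbability_delta _), supp_delta]
    exact subset_closure (H.mem_setMul.2 ⟨t, ht, _, rfl, H.e_mem_supp_conv_delta_inv t⟩)
  rw [H.conv_assoc, H.supp_conv (isProbability_delta _) (H.isProbability_conv_delta _ _),
    supp_delta, (H.isCompact_setMul isCompact_singleton
      (H.isCompact_supp_conv_delta _ _)).isClosed.closure_eq, mem_setMul] at he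
  obtain ⟨_, rfl, u, hu, heu⟩ := he
  have hxu := H.inv_mem_supp_conv_delta hu
  rwa [H.inv_inv, H.inv_inv, ← (H.e_mem_supp_iff _ _).1 heu] at hxu

theorem supp_eq_univ_of_forall_conv_delta_eq {μ : boundedRegularMeasures K} (hμ : IsProbability μ)
    (h : ∀ x, H.conv μ (delta x) = μ) : supp μ = univ := by
  have hsubset : ∀ y, H.setMul (supp μ) {y} ⊆ supp μ := fun y => by
    conv_rhs => rw [← h y, H.supp_conv hμ (isProbability_delta y), supp_delta]
    exact subset_closure
  obtain ⟨s, hs⟩ := hμ.supp_nonempty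
  have he : H.e ∈ supp μ :=
    hsubset (H.inv s) (H.mem_setMul.2 ⟨s, hs, _, rfl, H.e_mem_supp_conv_delta_inv s⟩)
  refine eq_univ_of_forall fun z => hsubset z (H.mem_setMul.2 ⟨H.e, he, z, rfl, ?_⟩)
  rw [e_conv, supp_delta]
  exact rfl

theorem mapInv_conv_delta_eq {μ : boundedRegularMeasures K}
    (h : ∀ x, H.conv (delta x) μ = μ) (x : K) :
    H.conv (H.mapInv μ) (delta x) = H.mapInv μ := by
  rw [← H.inv_inv x, ← mapInv_delta, ← mapInv_conv, h]

-- Both sides are `ρ * μ`.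
theorem pairing_one_smul_eq_of_invariant {μ ρ : boundedRegularMeasures K}
    (hμ : ∀ x, H.conv (delta x) μ = μ) (hρ : ∀ x, H.conv ρ (delta x) = ρ) :
    pairing ρ 1 • μ = pairing μ 1 • ρ :=
  (H.conv_eq_smul_of_forall_delta_conv_eq fun x _ => hμ x).symm.trans
    (H.conv_eq_smul_of_forall_conv_delta_eq fun x _ => hρ x)

namespace IsNormalizedHaar

variable {H} {ω : boundedRegularMeasures K}

theorem mapInv_eq (hω : H.IsNormalizedHaar ω) : H.mapInv ω = ω := by
  simpa only [(hω.1.mapHomeomorph H.invHomeomorph).pairing_one, mapInv, hω.1.pairing_one, one_smul]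
    using (H.pairing_one_smul_eq_of_invariant hω.2 (H.mapInv_conv_delta_eq hω.2)).symm

theorem conv_delta (hω : H.IsNormalizedHaar ω) (x : K) : H.conv ω (delta x) = ω := by
  simpa only [hω.mapInv_eq] using H.mapInv_conv_delta_eq hω.2 x

theorem setOf_invariant_eq_range_smul (hω : H.IsNormalizedHaar ω) :
    {μ | ∀ x, H.conv (delta x) μ = μ} = range fun c : ℂ => c • ω := by
  ext μ
  refine ⟨fun hμ => ⟨pairing μ 1, ?_⟩, ?_⟩
  · simpa only [hω.1.pairing_one, one_smul]
      using (H.pairing_one_smul_eq_of_invariant hμ hω.conv_delta).symm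
  · rintro ⟨c, rfl⟩ x
    rw [map_smul, hω.2]

end IsNormalizedHaar

/-- A bounded continuous function `h` is `σ`-harmonic if `h x = ∫ h d(δ_x * σ)` for all `x`. -/
def IsHarmonicFunction (σ : boundedRegularMeasures K) (h : K →ᵇ ℂ) : Prop :=
  ∀ x, pairing (H.conv (delta x) σ) h = h x

theorem isHarmonicFunction_representative {σ μ : boundedRegularMeasures K}
    (hμ : H.conv σ μ = μ) (φ : boundedRegularMeasures K →L[ℂ] ℂ) :
    H.IsHarmonicFunction σ (representative (φ ∘L H.convRight μ)) := fun x => by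
  simp only [pairing_representative, representative_apply, ContinuousLinearMap.comp_apply,
    convRight_apply, H.conv_assoc, hμ]

/-- The closed subhypergroup generated by the support of `σ`; it is all of `K` exactly if `σ` is
adapted. -/
def generatedSubhypergroup (σ : boundedRegularMeasures K) : Set K :=
  closure (⋃ n, H.setPow (supp σ ∪ H.inv '' supp σ) n)

theorem supp_subset_generatedSubhypergroup (σ : boundedRegularMeasures K) :
    supp σ ⊆ H.generatedSubhypergroup σ :=
  subset_union_left.trans ((subset_iUnion (H.setPow _) 0).trans subset_closure)

namespace IsHarmonicFunction

variable {H} {ω σ : boundedRegularMeasures K} {h : K →ᵇ ℂ}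

theorem pairing_conv_delta_mul_star_eq (hh : H.IsHarmonicFunction σ h) (hω : H.IsNormalizedHaar ω)
    (hσ : IsProbability σ) (x : K) :
    pairing (H.conv (delta x) σ) (h * star h) = h x * star (h x) := by
  set q := h * star h
  set d := representative (pairingCLM q ∘L H.convRight σ) - q with hd
  have hd_apply : ∀ x, d x = pairing (H.conv (delta x) σ) q - q x := fun x =>
    congrArg (· - q x) (representative_apply _ x)
  have hd_nonneg : 0 ≤ (d : K → ℂ) := fun x => by
    have hle := (H.isProbability_conv (isProbability_delta x) hσ).mul_star_pairing_le h
    rw [hh x] at hle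
    exact (hd_apply x).symm ▸ sub_nonneg.2 hle
  have hωσ : H.conv ω σ = ω := by
    rw [H.conv_eq_smul_of_forall_conv_delta_eq fun x _ => hω.conv_delta x, hσ.pairing_one,
      one_smul]
  have hd_pairing : pairing ω d = 0 := by
    rw [hd, ← pairingₗ_apply, map_sub, pairingₗ_apply, pairing_representative, sub_eq_zero]
    exact congrArg (pairingCLM q) hωσ
  have hd_zero := (hω.1.pairing_eq_zero_iff hd_nonneg).1 hd_pairing
  rw [H.supp_eq_univ_of_forall_conv_delta_eq hω.1 hω.conv_delta, eqOn_univ] at hd_zero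
  exact sub_eq_zero.1 ((hd_apply x).symm.trans (congrFun hd_zero x))

theorem eqOn_supp_conv_delta (hh : H.IsHarmonicFunction σ h) (hω : H.IsNormalizedHaar ω)
    (hσ : IsProbability σ) (x : K) {y : K} (hy : y ∈ supp σ) :
    EqOn h (fun _ => h x) (supp (H.conv (delta x) (delta y))) := by
  have hprob := H.isProbability_conv (isProbability_delta x) hσ
  have hconst : EqOn h (fun _ => h x) (supp (H.conv (delta x) σ)) := by
    have hvariance := hprob.eqOn_const_of_pairing_mul_star_eq (f := h)
    rw [hh x] at hvariance
    exact hvariance (hh.pairing_conv_delta_mul_star_eq hω hσ x)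
  refine hconst.mono ?_
  rw [H.supp_conv (isProbability_delta x) hσ, supp_delta]
  exact fun z hz => subset_closure (H.mem_setMul.2 ⟨x, rfl, y, hy, hz⟩)

theorem eqOn_supp_conv_delta_of_mem_union (hh : H.IsHarmonicFunction σ h)
    (hω : H.IsNormalizedHaar ω) (hσ : IsProbability σ) (x : K) {y : K}
    (hy : y ∈ supp σ ∪ H.inv '' supp σ) :
    EqOn h (fun _ => h x) (supp (H.conv (delta x) (delta y))) := by
  obtain hy | ⟨y, hy, rfl⟩ := hy
  · exact hh.eqOn_supp_conv_delta hω hσ x hy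
  · exact fun t ht => (hh.eqOn_supp_conv_delta hω hσ t hy
      (H.mem_supp_conv_delta_of_mem_supp_conv_delta_inv ht)).symm

theorem eqOn_generatedSubhypergroup (hh : H.IsHarmonicFunction σ h) (hω : H.IsNormalizedHaar ω)
    (hσ : IsProbability σ) : EqOn h (fun _ => h H.e) (H.generatedSubhypergroup σ) := by
  refine closure_minimal (iUnion_subset fun n => ?_) (isClosed_eq h.continuous continuous_const)
  induction n with
  | zero =>
    intro y hy
    refine hh.eqOn_supp_conv_delta_of_mem_union hω hσ H.e hy ?_
    rw [e_conv, supp_delta]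
    exact rfl
  | succ n ih =>
    intro z hz
    obtain ⟨x, hx, y, hy, hz⟩ := H.mem_setMul.1 hz
    exact (hh.eqOn_supp_conv_delta_of_mem_union hω hσ x hy hz).trans (ih hx)

end IsHarmonicFunction

end Hypergroup

end HypergroupTheory

end

open HypergroupTheory in
theorem mainTheorem8_general {K : Type*} [TopologicalSpace K] [LocallyCompactSpace K] [T2Space K]
    [MeasurableSpace K] [BorelSpace K] (H : Hypergroup K) {ω σ : boundedRegularMeasures K}
    (hω : H.IsNormalizedHaar ω) (hσ : IsProbability σ) :
    H.harmonicMeasures σ = {μ | ∀ x ∈ H.generatedSubhypergroup σ, H.conv (delta x) μ = μ} := by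
  ext μ
  refine ⟨fun hμ x hx => ext_pairing fun f => ?_, fun hμ => ?_⟩
  · have hharmonic := H.isHarmonicFunction_representative hμ (pairingCLM f)
    simpa only [representative_apply, ContinuousLinearMap.comp_apply, Hypergroup.convRight_apply,
      H.delta_e_conv, pairingCLM_apply] using hharmonic.eqOn_generatedSubhypergroup hω hσ hx
  · have hσμ := H.conv_eq_smul_of_forall_delta_conv_eq fun x hx =>
      hμ x (H.supp_subset_generatedSubhypergroup σ hx)
    rwa [hσ.pairing_one, one_smul] at hσμ

open HypergroupTheory in
theorem mainTheorem8 {K : Type*} [TopologicalSpace K] [CompactSpace K] [T2Space K]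
    [MeasurableSpace K] [BorelSpace K] (H : HypergroupTheory.Hypergroup K)
    (ω : HypergroupTheory.boundedRegularMeasures K) (hω : H.IsNormalizedHaar ω)
    (σ : HypergroupTheory.boundedRegularMeasures K)
    (hσ : HypergroupTheory.IsProbability σ) (hσa : H.IsAdapted σ) :
    H.harmonicMeasures σ = Set.range fun c : ℂ => c • ω := by
  have hgen : H.generatedSubhypergroup σ = univ := hσa
  simp only [mainTheorem8_general H hω hσ, hgen, mem_univ, true_implies,
    hω.setOf_invariant_eq_range_smul]
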